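/- Let $d\ge 4$ be even and identify the vertices of the ring graph on $d$ vertices with $\mathbb Z/d\mathbb Z$, two vertices $u,v$ being neighbours when $u-v\equiv\pm1 \pmod d$. Let $x=(x(n))_{n\in\mathbb Z/d\mathbb Z}$ be a circular stationary Gaussian process: a Gaussian random vector with constant mean and covariance $\Sigma(n,m)=\mathrm{Cov}(x(n),x(m))=\rho(n-m)$ for a function $\rho:\mathbb Z/d\mathbb Z\to\mathbb R$. Write $\|\Sigma\|_{op}$ for the operator norm of $\Sigma$ on Euclidean $\mathbb R^d$ and $\max_{n\ge2}\rho(n)$ for the maximum of $\rho(n)$ over $2\le n\le d-2$. Suppose that neighbouring vertices are the most correlated ones, $\rho(1)>\max_{n\ge2}\rho(n)$ (in particular $\rho(0)>0$), so that the correlation gap $$\Delta=\left(\sqrt{1-\frac{\max_{n\ge2}\rho(n)}{\rho(0)}}-\sqrt{1-\frac{\rho(1)}{\rho(0)}}\right)^2$$ is positive. Let $x_1,\dots,x_N$ be independent random vectors with the law of $x$, and let $\varepsilon>0$. A pairing is a bijection $\pi$ from $\{0,\dots,d-1\}$ to the vertices, which pairs $\pi(2n)$ with $\pi(2n+1)$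 for $0\le n<d/2$. If $$N>\frac{\pi^3}{2\Delta}\,\frac{\|\Sigma\|_{op}}{\rho(0)}\;d\,\bigl(3\log d-\log\varepsilon\bigr)$$ (where $\pi$ is the usual constant), then with probability larger than $1-\varepsilon$ every pairing that minimizes the empirical total variation $$\sum_{i=1}^N\sum_{n=0}^{d/2-1}\bigl|x_i(\pi(2n))-x_i(\pi(2n+1))\bigr|$$ over all pairings is connected, that is, pairs only neighbouring vertices. In particular, when $\rho(0)=1$ this holds as soon as $N>\frac{\pi^3\|\Sigma\|_{op}}{2\Delta}\,d\,(3\log d-\log\varepsilon)$. -/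

import Mathlib

open MeasureTheory ProbabilityTheory

noncomputable section

namespace RingPairing

/-- Two vertices of the ring graph on `ZMod d` are neighbours when they differ by `1` modulo `d`. -/
def Neighbor {d : ℕ} (u v : ZMod d) : Prop :=
  u - v = 1 ∨ v - u = 1

/-- `x : Ω → (ZMod d → ℝ)` is a circular stationary Gaussian process with (constant) mean `c` and
covariance `Cov (x n, x m) = ρ (n - m)`, the lag being taken modulo `d`. -/
structure IsCircularStationaryGaussian {Ω : Type*} [MeasurableSpace Ω] {d : ℕ} [NeZero d]
    (x : Ω → ZMod d → ℝ) (c : ℝ) (ρ : ZMod d → ℝ) (P : Measure Ω) : Prop where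
  gaussian : HasGaussianLaw x P
  mean : ∀ n, ∫ ω, x ω n ∂P = c
  cov : ∀ n m, cov[fun ω => x ω n, fun ω => x ω m; P] = ρ (n - m)

/-- The covariance matrix `Σ (n, m) = ρ (n - m)`. -/
def covMatrix {d : ℕ} (ρ : ZMod d → ℝ) : Matrix (ZMod d) (ZMod d) ℝ :=
  Matrix.circulant ρ

/-- The operator norm of `Σ` on `ℝ^d` with the Euclidean norm. -/
def covOpNorm {d : ℕ} [NeZero d] (ρ : ZMod d → ℝ) : ℝ :=
  ‖Matrix.toEuclideanCLM (𝕜 := ℝ) (covMatrix ρ)‖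

/-- `max_{n ≥ 2} ρ n`: the largest value of `ρ` at the lags between distinct vertices that are not
neighbours. For `4 ≤ d` this is a maximum over a nonempty finite set. -/
def maxFarCorr {d : ℕ} (ρ : ZMod d → ℝ) : ℝ :=
  sSup (ρ '' {n | n ≠ 0 ∧ n ≠ 1 ∧ n ≠ -1})

/-- The correlation gap `Δ`. -/
def corrGap {d : ℕ} (ρ : ZMod d → ℝ) : ℝ :=
  (Real.sqrt (1 - maxFarCorr ρ / ρ 0) - Real.sqrt (1 - ρ 1 / ρ 0)) ^ 2

/-- A pairing of the `d` vertices (`d` even), presented as an enumeration `π` of the vertices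
that pairs `π (2n)` with `π (2n+1)` for `0 ≤ n < d/2`. -/
abbrev Pairing (d : ℕ) := Fin d ≃ ZMod d

namespace Pairing

variable {d : ℕ}

/-- The vertex `π (2n)`. -/
def fst (π : Pairing d) (n : Fin (d / 2)) : ZMod d := π ⟨2 * n, by omega⟩

/-- The vertex `π (2n+1)`. -/
def snd (π : Pairing d) (n : Fin (d / 2)) : ZMod d := π ⟨2 * n + 1, by omega⟩

/-- A pairing is connected when it pairs only neighbouring vertices. -/
def IsConnected (π : Pairing d) : Prop :=
  ∀ n : Fin (d / 2), Neighbor (π.fst n) (π.snd n)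

/-- The empirical total variation of the samples `x 0, …, x (N-1)` along the pairing `π`. -/
def totalVariation {N : ℕ} (x : Fin N → ZMod d → ℝ) (π : Pairing d) : ℝ :=
  ∑ i : Fin N, ∑ n : Fin (d / 2), |x i (π.fst n) - x i (π.snd n)|

/-- `π` minimizes the empirical total variation among all pairings. -/
def IsMinimizer {N : ℕ} (x : Fin N → ZMod d → ℝ) (π : Pairing d) : Prop :=
  ∀ π' : Pairing d, totalVariation x π ≤ totalVariation x π'

end Pairing

end RingPairing

end

/-!
Fix a connected pairing `σ`. For a pairing `π`, the difference of the variations of one sample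
along `σ` and along `π` is a combination of absolute values of Gaussian linear forms, whose gradient
has squared norm at most `4 d`; by the Maurey–Pisier argument (rotate two independent copies into
one another, then apply Jensen's inequality to the integral along the rotation) it is sub-Gaussian
with constant `π² d ‖Σ‖`. Its mean is at most `-k √(4 ρ 0 Δ / π)`, where `k` is the number of far
pairs of `π`, those whose ends are not neighbours. Hence the total variation of `N` samples along
`π` is at most that along `σ` with probability at most `(ε / d³) ^ k`. Up to order, a pairing with a
far pair is determined by its far pairs, so the union bound is over at most `d ^ (2k)` pairings for
each `k ≥ 1`.
-/

section GaussianConcentration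

open ContinuousLinearMap (rotation)

open Real Set

lemma ofReal_exp_integral_le_lintegral_exp {α : Type*} [MeasurableSpace α] {μ : Measure α}
    [IsProbabilityMeasure μ] {g : α → ℝ} (hg : Integrable g μ) :
    ENNReal.ofReal (exp (∫ x, g x ∂μ)) ≤ ∫⁻ x, ENNReal.ofReal (exp (g x)) ∂μ := by
  have hexp_nonneg : 0 ≤ᵐ[μ] fun x => exp (g x) := ae_of_all _ fun _ => (exp_pos _).le
  by_cases hexp : Integrable (fun x => exp (g x)) μ
  · rw [← ofReal_integral_eq_lintegral_ofReal hexp hexp_nonneg]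
    exact ENNReal.ofReal_le_ofReal <| convexOn_exp.map_integral_le continuous_exp.continuousOn
      isClosed_univ (ae_of_all _ fun _ => mem_univ _) hg hexp
  · have htop := (lintegral_ofReal_ne_top_iff_integrable
      (continuous_exp.comp_aestronglyMeasurable hg.aestronglyMeasurable) hexp_nonneg).not.2 hexp
    rw [not_not.1 htop]
    exact le_top

/-- The mean of the second copy is pulled out of the exponential by Jensen's inequality. -/
lemma hasSubgaussianMGF_sub_integral_of_lintegral_exp_sub_le {α : Type*} [MeasurableSpace α]
    {μ : Measure α} [IsProbabilityMeasure μ] {f : α → ℝ} (hfm : Measurable f)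
    (hfi : Integrable f μ) {c : NNReal}
    (h : ∀ t : ℝ, ∫⁻ p, ENNReal.ofReal (exp (t * f p.2 - t * f p.1)) ∂(μ.prod μ) ≤
      ENNReal.ofReal (exp (c * t ^ 2 / 2))) :
    HasSubgaussianMGF (fun x => f x - ∫ y, f y ∂μ) c μ := by
  have hle (t : ℝ) : ∫⁻ y, ENNReal.ofReal (exp (t * (f y - ∫ x, f x ∂μ))) ∂μ ≤
      ENNReal.ofReal (exp (c * t ^ 2 / 2)) := by
    refine le_trans ?_ (h t)
    rw [lintegral_prod_symm _ (by fun_prop)]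
    refine lintegral_mono fun y => ?_
    have hmean : ∫ x, t * f y - t * f x ∂μ = t * (f y - ∫ x, f x ∂μ) := by
      rw [integral_sub (integrable_const _) (hfi.const_mul t)]
      simp [mul_sub, integral_const_mul]
    rw [← hmean]
    exact ofReal_exp_integral_le_lintegral_exp ((integrable_const _).sub (hfi.const_mul t))
  have hexp_nonneg (t : ℝ) : 0 ≤ᵐ[μ] fun y => exp (t * (f y - ∫ x, f x ∂μ)) :=
    ae_of_all _ fun _ => (exp_pos _).le
  have hint (t : ℝ) : Integrable (fun y => exp (t * (f y - ∫ x, f x ∂μ))) μ :=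
    (lintegral_ofReal_ne_top_iff_integrable (by fun_prop) (hexp_nonneg t)).1
      (ne_top_of_le_ne_top ENNReal.ofReal_ne_top (hle t))
  refine ⟨hint, fun t => ?_⟩
  have hmgf := hle t
  rwa [← ofReal_integral_eq_lintegral_ofReal (hint t) (hexp_nonneg t),
    ENNReal.ofReal_le_ofReal_iff (exp_pos _).le] at hmgf

variable {E : Type*} [NormedAddCommGroup E] [NormedSpace ℝ E] [MeasurableSpace E] [BorelSpace E]
  [SecondCountableTopology E] [CompleteSpace E] {μ : Measure E} [IsGaussian μ]

lemma lintegral_exp_dual_of_centered (hμ : μ[id] = 0) (L : StrongDual ℝ E) :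
    ∫⁻ y, ENNReal.ofReal (exp (L y)) ∂μ = ENNReal.ofReal (exp (Var[L; μ] / 2)) := by
  have hmap : μ.map L = gaussianReal 0 (Var[L; μ]).toNNReal := by
    have hmean : μ[L] = L (μ[id]) := IsGaussian.integral_dual L
    rw [IsGaussian.map_eq_gaussianReal L, hmean, hμ, map_zero]
  have hint : Integrable (fun y => exp (L y)) μ := by
    have h := integrable_exp_mul_gaussianReal (μ := 0) (v := (Var[L; μ]).toNNReal) 1
    rw [← hmap, integrable_map_measure (by fun_prop) (by fun_prop)] at h
    simpa only [Function.comp_def, one_mul] using h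
  have hmgf := mgf_gaussianReal hmap 1
  simp only [mgf, one_mul, zero_add, one_pow, mul_one,
    coe_toNNReal _ (variance_nonneg _ _)] at hmgf
  rw [← ofReal_integral_eq_lintegral_ofReal hint (ae_of_all _ fun _ => (exp_pos _).le), hmgf]

lemma lintegral_exp_mul_rotation_le (hμ : μ[id] = 0) {f' : E → StrongDual ℝ E}
    (hf' : Measurable fun p : E × E => f' p.1 p.2) {s : ℝ} (hs : ∀ x, Var[f' x; μ] ≤ s)
    (r θ : ℝ) :
    ∫⁻ p : E × E, ENNReal.ofReal (exp (r * f' (rotation θ p).1 (rotation θ p).2)) ∂(μ.prod μ) ≤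
      ENNReal.ofReal (exp (r ^ 2 * s / 2)) := by
  have hm : Measurable fun p : E × E => ENNReal.ofReal (exp (r * f' p.1 p.2)) := by fun_prop
  calc ∫⁻ p : E × E, ENNReal.ofReal (exp (r * f' (rotation θ p).1 (rotation θ p).2)) ∂(μ.prod μ)
      = ∫⁻ p, ENNReal.ofReal (exp (r * f' p.1 p.2))
          ∂((μ.prod μ).map (rotation θ)) :=
        (lintegral_map hm (by fun_prop)).symm
    _ = ∫⁻ x, ∫⁻ y, ENNReal.ofReal (exp ((r • f' x) y)) ∂μ ∂μ := by
        rw [IsGaussian.map_rotation_eq_self hμ, lintegral_prod _ hm.aemeasurable]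
        rfl
    _ ≤ ∫⁻ _, ENNReal.ofReal (exp (r ^ 2 * s / 2)) ∂μ := by
        refine lintegral_mono fun x => ?_
        rw [lintegral_exp_dual_of_centered hμ, FunLike.coe_smul, variance_smul]
        gcongr
        exact hs x
    _ = ENNReal.ofReal (exp (r ^ 2 * s / 2)) := by simp

lemma intervalIntegral_eq_integral_cond {a b : ℝ} (hab : a < b) (g : ℝ → ℝ) :
    ∫ θ in a..b, g θ = ∫ θ, (b - a) * g θ ∂(volume[|Ioc a b]) := by
  have hba : b - a ≠ 0 := (sub_pos.2 hab).ne'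
  rw [ProbabilityTheory.cond, integral_smul_measure, integral_const_mul, volume_Ioc,
    ENNReal.toReal_inv, ENNReal.toReal_ofReal (sub_pos.2 hab).le, smul_eq_mul,
    inv_mul_cancel_left₀ hba, intervalIntegral.integral_of_le hab.le]

/-- **Maurey–Pisier inequality**. The rotations of the plane preserve `μ.prod μ`, so Jensen's
inequality along the quarter circle from `p.1` to `p.2` reduces the increment of `f` to the
Gaussian linear form `f' x` at a fixed `x`. -/
lemma lintegral_exp_sub_le_of_integral_rotation (hμ : μ[id] = 0) {f : E → ℝ}
    {f' : E → StrongDual ℝ E} (hf' : Measurable fun p : E × E => f' p.1 p.2)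
    (hint : ∀ p : E × E, IntervalIntegrable
      (fun θ => f' (rotation θ p).1 (rotation θ p).2) volume 0 (π / 2))
    (hftc : ∀ p : E × E,
      ∫ θ in (0 : ℝ)..(π / 2), f' (rotation θ p).1 (rotation θ p).2 = f p.2 - f p.1)
    {s : ℝ} (hs : ∀ x, Var[f' x; μ] ≤ s) :
    ∫⁻ p, ENNReal.ofReal (exp (f p.2 - f p.1)) ∂(μ.prod μ) ≤
      ENNReal.ofReal (exp ((π / 2) ^ 2 * s / 2)) := by
  let κ : Measure ℝ := volume[|Ioc 0 (π / 2)]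
  let G (p : E × E) (θ : ℝ) : ℝ :=
    f' (rotation θ p).1 (rotation θ p).2
  have hG : Measurable (Function.uncurry G) := by
    have hrot : Continuous fun q : (E × E) × ℝ => rotation q.2 q.1 := by
      simp only [ContinuousLinearMap.rotation_apply]
      fun_prop
    exact hf'.comp hrot.measurable
  have : IsProbabilityMeasure κ :=
    cond_isProbabilityMeasure_of_finite (by simp [pi_pos]) (by simp)
  have hGκ (p : E × E) : Integrable (fun θ => π / 2 * G p θ) κ :=
    (((intervalIntegrable_iff_integrableOn_Ioc_of_le (by positivity)).1
      (hint p)).smul_measure (by simp [pi_pos])).const_mul _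
  calc ∫⁻ p, ENNReal.ofReal (exp (f p.2 - f p.1)) ∂(μ.prod μ)
      ≤ ∫⁻ p, ∫⁻ θ, ENNReal.ofReal (exp (π / 2 * G p θ)) ∂κ ∂(μ.prod μ) := by
        refine lintegral_mono fun p => ?_
        rw [← hftc p, intervalIntegral_eq_integral_cond (by positivity), sub_zero]
        exact ofReal_exp_integral_le_lintegral_exp (hGκ p)
    _ = ∫⁻ θ, ∫⁻ p, ENNReal.ofReal (exp (π / 2 * G p θ)) ∂(μ.prod μ) ∂κ :=
        lintegral_lintegral_swap
          (hG.const_mul (π / 2)).exp.ennreal_ofReal.aemeasurable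
    _ ≤ ∫⁻ _, ENNReal.ofReal (exp ((π / 2) ^ 2 * s / 2)) ∂κ :=
        lintegral_mono fun θ => lintegral_exp_mul_rotation_le hμ hf' hs (π / 2) θ
    _ = ENNReal.ofReal (exp ((π / 2) ^ 2 * s / 2)) := by simp

lemma hasSubgaussianMGF_sub_integral_of_integral_rotation (hμ : μ[id] = 0) {f : E → ℝ}
    (hfm : Measurable f) (hfi : Integrable f μ)
    {f' : E → StrongDual ℝ E} (hf' : Measurable fun p : E × E => f' p.1 p.2)
    (hint : ∀ p : E × E, IntervalIntegrable
      (fun θ => f' (rotation θ p).1 (rotation θ p).2) volume 0 (π / 2))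
    (hftc : ∀ p : E × E,
      ∫ θ in (0 : ℝ)..(π / 2), f' (rotation θ p).1 (rotation θ p).2 = f p.2 - f p.1)
    {s : ℝ} (hs : ∀ x, Var[f' x; μ] ≤ s) :
    HasSubgaussianMGF (fun x => f x - ∫ y, f y ∂μ) (toNNReal ((π / 2) ^ 2 * s)) μ := by
  refine hasSubgaussianMGF_sub_integral_of_lintegral_exp_sub_le hfm hfi fun t => ?_
  have hs0 : 0 ≤ s := (variance_nonneg _ _).trans (hs 0)
  have hbound := lintegral_exp_sub_le_of_integral_rotation hμ (f := fun x => t * f x)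
    (f' := fun x => t • f' x) (s := t ^ 2 * s)
    (by simpa using hf'.const_mul t)
    (fun p => by simpa using (hint p).const_mul t)
    (fun p => by simp [hftc, mul_sub])
    (fun x => by
      rw [FunLike.coe_smul, variance_smul]
      gcongr
      exact hs x)
  rw [coe_toNNReal _ (by positivity)]
  convert hbound using 4
  ring

end GaussianConcentration

section AbsoluteValue

lemma measurable_coe_sign : Measurable fun r : ℝ => (SignType.sign r : ℝ) := by
  have h : (fun r : ℝ => (SignType.sign r : ℝ)) = deriv fun r => |r| :=
    funext fun r => (deriv_abs r).symm
  rw [h]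
  exact measurable_deriv _

lemma abs_coe_sign_le_one (r : ℝ) : |(SignType.sign r : ℝ)| ≤ 1 := by
  cases SignType.sign r <;> simp

/-- At a zero of `u` both sides vanish: `|u|` has a minimum there, and `deriv` is `0` where `|u|` is
not differentiable. -/
lemma deriv_abs_comp {u : ℝ → ℝ} (hu : Differentiable ℝ u) :
    deriv (fun θ => |u θ|) = fun θ => SignType.sign (u θ) * deriv u θ := by
  funext θ
  rcases eq_or_ne (u θ) 0 with h0 | h0
  · have hmin : IsLocalMin (fun θ => |u θ|) θ :=
      Filter.Eventually.of_forall fun θ' => by simp [h0]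
    simp [h0, hmin.deriv_eq_zero]
  · exact ((hasDerivAt_abs h0).comp θ (hu θ).hasDerivAt).deriv

variable {u : ℝ → ℝ}

lemma absolutelyContinuousOnInterval_abs_comp (hu : ContDiff ℝ 1 u) (a b : ℝ) :
    AbsolutelyContinuousOnInterval (fun θ => |u θ|) a b := by
  obtain ⟨K, hK⟩ := hu.contDiffOn.exists_lipschitzOnWith (n := 1) one_ne_zero
    (convex_uIcc a b) isCompact_uIcc
  exact (lipschitzWith_one_norm.comp_lipschitzOnWith hK).absolutelyContinuousOnInterval

lemma intervalIntegrable_sign_mul_deriv (hu : ContDiff ℝ 1 u) (a b : ℝ) :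
    IntervalIntegrable (fun θ => SignType.sign (u θ) * deriv u θ) volume a b := by
  rw [← deriv_abs_comp (hu.differentiable one_ne_zero)]
  exact (absolutelyContinuousOnInterval_abs_comp hu a b).intervalIntegrable_deriv

lemma integral_sign_mul_deriv (hu : ContDiff ℝ 1 u) (a b : ℝ) :
    ∫ θ in a..b, SignType.sign (u θ) * deriv u θ = |u b| - |u a| := by
  rw [← deriv_abs_comp (hu.differentiable one_ne_zero)]
  exact (absolutelyContinuousOnInterval_abs_comp hu a b).integral_deriv_eq_sub

end AbsoluteValue

section AbsoluteLinearForms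

open ContinuousLinearMap (rotation)

open Real

variable {E : Type*} [NormedAddCommGroup E] [NormedSpace ℝ E] {ι : Type*} [Fintype ι]

/-- The gradient of the weighted sum `∑ j, w j * |L j x + c j|` of absolute values of affine forms,
with the convention `sign 0 = 0` where it is not differentiable. -/
noncomputable def absSumGradient (L : ι → StrongDual ℝ E) (w c : ι → ℝ) (x : E) : StrongDual ℝ E :=
  ∑ j, (w j * SignType.sign (L j x + c j)) • L j

lemma absSumGradient_apply (L : ι → StrongDual ℝ E) (w c : ι → ℝ) (x y : E) :
    absSumGradient L w c x y = ∑ j, w j * (SignType.sign (L j x + c j) * L j y) := by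
  simp [absSumGradient, mul_assoc]

lemma contDiff_affine_rotation (L : StrongDual ℝ E) (c : ℝ) (p : E × E) :
    ContDiff ℝ 1 fun θ : ℝ => L (rotation θ p).1 + c := by
  simp only [ContinuousLinearMap.rotation_apply, map_add, map_smul, smul_eq_mul]
  fun_prop

lemma deriv_affine_rotation (L : StrongDual ℝ E) (c : ℝ) (p : E × E) (θ : ℝ) :
    deriv (fun θ : ℝ => L (rotation θ p).1 + c) θ = L (rotation θ p).2 := by
  have h : HasDerivAt (fun θ : ℝ => cos θ * L p.1 + sin θ * L p.2 + c)
      (-sin θ * L p.1 + cos θ * L p.2) θ :=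
    (((hasDerivAt_cos θ).mul_const _).add ((hasDerivAt_sin θ).mul_const _)).add_const c
  simp [ContinuousLinearMap.rotation_apply, h.deriv]

lemma absSumGradient_rotation (L : ι → StrongDual ℝ E) (w c : ι → ℝ) (p : E × E) (θ : ℝ) :
    absSumGradient L w c (rotation θ p).1 (rotation θ p).2 =
      ∑ j, w j * (SignType.sign (L j (rotation θ p).1 + c j) *
        deriv (fun θ : ℝ => L j (rotation θ p).1 + c j) θ) := by
  simp only [absSumGradient_apply, deriv_affine_rotation]

lemma intervalIntegrable_absSumGradient_rotation (L : ι → StrongDual ℝ E) (w c : ι → ℝ)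
    (p : E × E) (a b : ℝ) :
    IntervalIntegrable (fun θ => absSumGradient L w c (rotation θ p).1 (rotation θ p).2)
      volume a b := by
  simp only [absSumGradient_rotation]
  simpa only [Finset.sum_fn] using IntervalIntegrable.sum Finset.univ fun j _ =>
    (intervalIntegrable_sign_mul_deriv
      (contDiff_affine_rotation (L j) (c j) p) a b).const_mul (w j)

lemma integral_absSumGradient_rotation (L : ι → StrongDual ℝ E) (w c : ι → ℝ) (p : E × E) :
    ∫ θ in (0 : ℝ)..(π / 2), absSumGradient L w c (rotation θ p).1 (rotation θ p).2 =
      ∑ j, w j * |L j p.2 + c j| - ∑ j, w j * |L j p.1 + c j| := by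
  simp only [absSumGradient_rotation]
  have hC1 (j : ι) := contDiff_affine_rotation (L j) (c j) p
  rw [intervalIntegral.integral_finsetSum fun j _ =>
    (intervalIntegrable_sign_mul_deriv (hC1 j) 0 (π / 2)).const_mul _]
  simp_rw [intervalIntegral.integral_const_mul, fun j => integral_sign_mul_deriv (hC1 j),
    ContinuousLinearMap.rotation_apply]
  simp [mul_sub]

variable [MeasurableSpace E] [BorelSpace E]

lemma measurable_absSumGradient (L : ι → StrongDual ℝ E) (w c : ι → ℝ) :
    Measurable fun p : E × E => absSumGradient L w c p.1 p.2 := by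
  simp only [absSumGradient_apply]
  exact Finset.measurable_sum _ fun j _ =>
    ((measurable_coe_sign.comp (by fun_prop)).mul (by fun_prop)).const_mul _

variable [SecondCountableTopology E]

lemma hasSubgaussianMGF_sum_abs_affine_of_centered [CompleteSpace E] {μ : Measure E} [IsGaussian μ]
    (hμ : μ[id] = 0) (L : ι → StrongDual ℝ E) (w c : ι → ℝ) {s : ℝ}
    (hs : ∀ a : ι → ℝ, (∀ j, |a j| ≤ |w j|) → Var[fun x => ∑ j, a j * L j x; μ] ≤ s) :
    HasSubgaussianMGF
      (fun x => ∑ j, w j * |L j x + c j| - ∫ y, ∑ j, w j * |L j y + c j| ∂μ)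
      (toNNReal ((π / 2) ^ 2 * s)) μ := by
  refine hasSubgaussianMGF_sub_integral_of_integral_rotation hμ
    (f := fun x => ∑ j, w j * |L j x + c j|) (by fun_prop) ?_ (measurable_absSumGradient L w c)
    (fun p => intervalIntegrable_absSumGradient_rotation L w c p _ _)
    (integral_absSumGradient_rotation L w c) fun x => ?_
  · exact integrable_finsetSum _ fun j _ =>
      (((IsGaussian.integrable_dual μ (L j)).add (integrable_const _)).abs).const_mul _
  · refine le_trans (le_of_eq ?_) (hs (fun j => w j * SignType.sign (L j x + c j)) fun j => ?_)
    · congr 1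
      funext y
      simp only [absSumGradient_apply, mul_assoc]
    · rw [abs_mul]
      exact mul_le_of_le_one_right (abs_nonneg _) (abs_coe_sign_le_one _)

/-- **Gaussian concentration** for a weighted sum of absolute values of linear forms. The shifts
`c j` of the centered case absorb the mean. -/
lemma hasSubgaussianMGF_sum_abs_dual [CompleteSpace E] {Ω : Type*} [MeasurableSpace Ω]
    {P : Measure Ω} {X : Ω → E} (hX : HasGaussianLaw X P)
    (L : ι → StrongDual ℝ E) (w : ι → ℝ) {s : ℝ}
    (hs : ∀ a : ι → ℝ, (∀ j, |a j| ≤ |w j|) → Var[fun ω => ∑ j, a j * L j (X ω); P] ≤ s) :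
    HasSubgaussianMGF
      (fun ω => ∑ j, w j * |L j (X ω)| - ∫ ω', ∑ j, w j * |L j (X ω')| ∂P)
      (toNNReal ((π / 2) ^ 2 * s)) P := by
  have := hX.isProbabilityMeasure
  set m : E := ∫ ω, X ω ∂P with hm
  let Y : Ω → E := fun ω => X ω - m
  have hXm : AEMeasurable X P := hX.aemeasurable
  have hYm : AEMeasurable Y P := hXm.sub_const m
  have hmap : P.map Y = (P.map X).map (· - m) :=
    (AEMeasurable.map_map_of_aemeasurable (measurable_sub_const m).aemeasurable hXm).symm
  have hgauss : IsGaussian (P.map X) := hX.isGaussian_map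
  have hY : IsGaussian (P.map Y) := by rw [hmap]; infer_instance
  have hcenter : (P.map Y)[id] = 0 := by
    rw [integral_map hYm (by fun_prop)]
    simp [Y, integral_sub hX.integrable (integrable_const _), ← hm]
  have hshift (ω : Ω) (j : ι) : L j (X ω) = L j (Y ω) + L j m := by simp [Y]
  have hvar (a : ι → ℝ) (ha : ∀ j, |a j| ≤ |w j|) :
      Var[fun y => ∑ j, a j * L j y; P.map Y] ≤ s := by
    refine le_trans (le_of_eq ?_) (hs a ha)
    rw [variance_map (by fun_prop) hYm]
    have hsum : (fun ω => ∑ j, a j * L j (X ω)) =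
        fun ω => ∑ j, a j * L j (Y ω) + ∑ j, a j * L j m := by
      simp only [hshift, mul_add, Finset.sum_add_distrib]
    rw [hsum, variance_add_const (by fun_prop)]
    rfl
  have hsub :=
    (hasSubgaussianMGF_sum_abs_affine_of_centered hcenter L w (fun j => L j m) hvar).of_map hYm
  rw [integral_map hYm (by fun_prop)] at hsub
  simpa only [Function.comp_def, hshift] using hsub

end AbsoluteLinearForms

section GaussianAbsoluteMoment

open Real

/-- Both sides are even, so the integral reduces to `∫ y in Ioi 0, y * exp (-y² / (2v))`, a value
of the Gamma function. -/
lemma integral_abs_gaussianReal (v : NNReal) :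
    ∫ x, |x| ∂(gaussianReal 0 v) = √(2 * v / π) := by
  rcases eq_or_ne v 0 with rfl | hv
  · simp
  have hv_pos : (0 : ℝ) < v := by positivity
  let g (y : ℝ) : ℝ := (√(2 * π * v))⁻¹ * (y ^ (1 : ℝ) * exp (-(2 * (v : ℝ))⁻¹ * y ^ (2 : ℝ)))
  have hdensity (x : ℝ) : gaussianPDFReal 0 v x • |x| = g |x| := by
    simp only [g, gaussianPDFReal, smul_eq_mul, sub_zero, rpow_one, rpow_two, sq_abs]
    rw [show -x ^ 2 / (2 * (v : ℝ)) = -(2 * (v : ℝ))⁻¹ * x ^ 2 by ring]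
    ring
  simp only [integral_gaussianReal_eq_integral_smul hv, hdensity]
  rw [integral_comp_abs, integral_const_mul,
    integral_rpow_mul_exp_neg_mul_rpow (by norm_num) (by norm_num) (by positivity)]
  norm_num [rpow_neg_one]
  field_simp
  rw [sq_sqrt hv_pos.le, sq_sqrt zero_le_two]
  ring

lemma integral_abs_of_hasGaussianLaw_of_centered {Ω : Type*} [MeasurableSpace Ω] {P : Measure Ω}
    {Y : Ω → ℝ} (hY : HasGaussianLaw Y P) (hcenter : ∫ ω, Y ω ∂P = 0) :
    ∫ ω, |Y ω| ∂P = √(2 * Var[Y; P] / π) := by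
  have hmap : P.map Y = gaussianReal 0 (Var[Y; P]).toNNReal := by
    rw [hY.map_eq_gaussianReal, hcenter]
  rw [← integral_map (φ := Y) (f := fun y => |y|) hY.aemeasurable (by fun_prop), hmap,
    integral_abs_gaussianReal, coe_toNNReal _ (variance_nonneg _ _)]

end GaussianAbsoluteMoment

section IndependentSums

open Real

lemma measureReal_sum_nonneg_le_of_iIndepFun {Ω Ω' α : Type*} [MeasurableSpace Ω]
    [MeasurableSpace Ω'] [MeasurableSpace α] {P : Measure Ω} {P' : Measure Ω'} {x : Ω → α}
    {ι : Type*} [Fintype ι] {X : ι → Ω' → α} (hX : ∀ i, IdentDistrib (X i) x P' P)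
    (hX_indep : iIndepFun X P') {f : α → ℝ} (hf : Measurable f) {c : NNReal}
    (hsub : HasSubgaussianMGF (fun ω => f (x ω) - ∫ ω', f (x ω') ∂P) c P) {δ : ℝ} (hδ : 0 ≤ δ)
    (hmean : ∫ ω, f (x ω) ∂P ≤ -δ) :
    P'.real {ω | 0 ≤ ∑ i, f (X i ω)} ≤ exp (-(Fintype.card ι * δ ^ 2 / (2 * c))) := by
  let Y (i : ι) (ω : Ω') : ℝ := f (X i ω) - ∫ ω', f (x ω') ∂P
  have hY_indep : iIndepFun Y P' := hX_indep.comp (fun _ y => f y - _) fun _ => by fun_prop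
  have hY_sub (i : ι) : HasSubgaussianMGF (Y i) c P' :=
    hsub.congr_identDistrib ((hX i).comp (u := fun y => f y - _) (by fun_prop)).symm
  have hprob : IsProbabilityMeasure P' := hX_indep.isProbabilityMeasure
  calc P'.real {ω | 0 ≤ ∑ i, f (X i ω)}
      ≤ P'.real {ω | Fintype.card ι * δ ≤ ∑ i, Y i ω} := by
        refine measureReal_mono fun ω hω => ?_
        simp only [Set.mem_ofPred_eq, Y, Finset.sum_sub_distrib, Finset.sum_const, nsmul_eq_mul,
          Finset.card_univ] at hω ⊢
        nlinarith [(Fintype.card ι).cast_nonneg (α := ℝ)]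
    _ ≤ exp (-(Fintype.card ι * δ) ^ 2 / (2 * ∑ _i : ι, (c : ℝ))) :=
        mod_cast HasSubgaussianMGF.measure_sum_ge_le_of_iIndepFun hY_indep (s := Finset.univ)
          (fun i _ => hY_sub i) (by positivity)
    _ = exp (-(Fintype.card ι * δ ^ 2 / (2 * c))) := by
        rcases eq_or_ne (Fintype.card ι : ℝ) 0 with h0 | h0
        · simp [h0]
        · congr 1
          simp only [Finset.sum_const, Finset.card_univ, nsmul_eq_mul]
          rw [show 2 * (Fintype.card ι * (c : ℝ)) = Fintype.card ι * (2 * c) by ring,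
            show -(Fintype.card ι * δ) ^ 2 = Fintype.card ι * -(Fintype.card ι * δ ^ 2) by ring,
            mul_div_mul_left _ _ h0, neg_div]

end IndependentSums

section UnionBound

lemma sum_nonempty_pow_card {α R : Type*} [Fintype α] [CommRing R] (p : R) :
    ∑ F : Finset α with F.Nonempty, p ^ F.card = (1 + p) ^ Fintype.card α - 1 := by
  classical
  have hall := Fintype.sum_pow_mul_eq_add_pow α p 1
  have hempty : ({F | ¬ F.Nonempty} : Finset (Finset α)) = {∅} := by
    ext F
    simp [Finset.not_nonempty_iff_eq_empty]
  rw [← Finset.sum_filter_add_sum_filter_not _ Finset.Nonempty, hempty] at hall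
  simp only [one_pow, mul_one, Finset.sum_singleton, Finset.card_empty, pow_zero] at hall
  rw [add_comm 1 p, ← hall, add_sub_cancel_right]

lemma one_add_pow_sub_one_le {p : ℝ} (hp : 0 ≤ p) {n : ℕ} (hnp : n * p ≤ 1) :
    (1 + p) ^ n - 1 ≤ 2 * (n * p) := by
  have hnp0 : 0 ≤ n * p := by positivity
  calc (1 + p) ^ n - 1
      ≤ Real.exp p ^ n - 1 := by
        gcongr
        linarith [Real.add_one_le_exp p]
    _ = Real.exp (n * p) - 1 := by rw [Real.exp_nat_mul]
    _ ≤ |Real.exp (n * p) - 1| := le_abs_self _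
    _ ≤ 2 * |n * p| := Real.abs_exp_sub_one_le (abs_le.2 ⟨by linarith, hnp⟩)
    _ = 2 * (n * p) := by rw [abs_of_nonneg hnp0]

end UnionBound

namespace RingPairing

lemma neighbor_comm {d : ℕ} {u v : ZMod d} : Neighbor u v ↔ Neighbor v u := or_comm

section Involutions

variable {d : ℕ} {σ τ : ZMod d → ZMod d}

lemma apply_add_one_eq_of_sub_eq_one (hσ : σ.Involutive) (hτ : τ.Involutive) {s : ZMod d}
    (hs : σ s = τ s) (h : (s + 1) - σ (s + 1) = 1) : σ (s + 1) = τ (s + 1) := by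
  have hback : σ (s + 1) = s := by linear_combination -h
  have hforth : σ s = s + 1 := by rw [← hback, hσ, hback]
  rw [hback, ← hforth, hs, hτ]

/-- The values propagate around the ring: where both involutions move `s + 1` to a neighbour, one
that moves it to `s` forces the other to do so, since they agree at `s`. -/
lemma eq_of_eq_of_not_neighbor [NeZero d] (hσ : σ.Involutive) (hτ : τ.Involutive)
    (hfar : ∀ v, ¬ Neighbor v (σ v) ∨ ¬ Neighbor v (τ v) → σ v = τ v) {s : ZMod d}
    (hs : σ s = τ s) : σ = τ := by
  have hstep (t : ZMod d) (ht : σ t = τ t) : σ (t + 1) = τ (t + 1) := by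
    by_contra hne
    obtain ⟨hσn, hτn⟩ : Neighbor (t + 1) (σ (t + 1)) ∧ Neighbor (t + 1) (τ (t + 1)) := by
      by_contra h
      exact hne (hfar _ (not_and_or.1 h))
    rcases hσn with hσb | hσf
    · exact hne (apply_add_one_eq_of_sub_eq_one hσ hτ ht hσb)
    rcases hτn with hτb | hτf
    · exact hne (apply_add_one_eq_of_sub_eq_one hτ hσ ht.symm hτb).symm
    · exact hne (by linear_combination hσf - hτf)
  have hall (j : ℕ) : σ (s + j) = τ (s + j) := by
    induction j with
    | zero => simpa using hs
    | succ j ih => simpa [add_assoc] using hstep _ ih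
  funext v
  simpa using hall (v - s).val

end Involutions

namespace Pairing

variable {d : ℕ}

lemma fst_ne_snd (π : Pairing d) (n : Fin (d / 2)) : π.fst n ≠ π.snd n :=
  π.injective.ne (by simp)

/-- The total variation of a single sample along `π`. -/
noncomputable def variation (π : Pairing d) (z : ZMod d → ℝ) : ℝ :=
  ∑ n, |z (π.fst n) - z (π.snd n)|

lemma totalVariation_eq_sum_variation {N : ℕ} (x : Fin N → ZMod d → ℝ) (π : Pairing d) :
    totalVariation x π = ∑ i, π.variation (x i) := rfl

open Classical in
/-- The pairs `(π (2n), π (2n+1))` whose ends are not neighbours. They form the index of the union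
bound over the pairings that are not connected. -/
noncomputable def farPairs (π : Pairing d) : Finset (ZMod d × ZMod d) :=
  (Finset.univ.filter fun n => ¬ Neighbor (π.fst n) (π.snd n)).image fun n => (π.fst n, π.snd n)

lemma mem_farPairs {π : Pairing d} {q : ZMod d × ZMod d} :
    q ∈ π.farPairs ↔ ∃ n, ¬ Neighbor (π.fst n) (π.snd n) ∧ (π.fst n, π.snd n) = q := by
  simp [farPairs]

lemma isConnected_iff_farPairs_eq_empty {π : Pairing d} : π.IsConnected ↔ π.farPairs = ∅ := by
  simp [IsConnected, farPairs, Finset.filter_eq_empty_iff]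

variable [NeZero d]

lemma bijective_sumElim (hd : Even d) (π : Pairing d) :
    (Sum.elim π.fst π.snd).Bijective := by
  rw [Fintype.bijective_iff_injective_and_card]
  constructor
  · rintro (m | m) (n | n) h <;>
      simp only [Sum.elim_inl, Sum.elim_inr, fst, snd, EmbeddingLike.apply_eq_iff_eq,
        Fin.mk.injEq, Sum.inl.injEq, Sum.inr.injEq, reduceCtorEq] at h ⊢ <;> omega
  · have := Nat.even_iff.1 hd
    simp only [Fintype.card_sum, Fintype.card_fin, ZMod.card]
    omega

/-- The enumeration of the vertices by the first and the second ends of the pairs of `π`. -/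
noncomputable def vertexEquiv (hd : Even d) (π : Pairing d) : Fin (d / 2) ⊕ Fin (d / 2) ≃ ZMod d :=
  Equiv.ofBijective _ (bijective_sumElim hd π)

/-- The involution that exchanges the two ends of each pair of `π`. It forgets the order in which
`π` enumerates the pairs and their ends. -/
noncomputable def partner (hd : Even d) (π : Pairing d) (v : ZMod d) : ZMod d :=
  vertexEquiv hd π ((vertexEquiv hd π).symm v).swap

@[simp]
lemma vertexEquiv_inl (hd : Even d) (π : Pairing d) (n : Fin (d / 2)) :
    vertexEquiv hd π (.inl n) = π.fst n := rfl

@[simp]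
lemma vertexEquiv_inr (hd : Even d) (π : Pairing d) (n : Fin (d / 2)) :
    vertexEquiv hd π (.inr n) = π.snd n := rfl

lemma partner_vertexEquiv (hd : Even d) (π : Pairing d) (q : Fin (d / 2) ⊕ Fin (d / 2)) :
    partner hd π (vertexEquiv hd π q) = vertexEquiv hd π q.swap := by
  rw [partner, Equiv.symm_apply_apply]

@[simp]
lemma partner_fst (hd : Even d) (π : Pairing d) (n : Fin (d / 2)) :
    partner hd π (π.fst n) = π.snd n :=
  partner_vertexEquiv hd π (.inl n)

@[simp]
lemma partner_snd (hd : Even d) (π : Pairing d) (n : Fin (d / 2)) :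
    partner hd π (π.snd n) = π.fst n :=
  partner_vertexEquiv hd π (.inr n)

lemma partner_involutive (hd : Even d) (π : Pairing d) : (partner hd π).Involutive := by
  intro v
  simp [partner]

lemma exists_eq_fst_or_eq_snd (hd : Even d) (π : Pairing d) (v : ZMod d) :
    ∃ n, v = π.fst n ∨ v = π.snd n := by
  obtain ⟨n | n, rfl⟩ := (vertexEquiv hd π).surjective v
  exacts [⟨n, .inl rfl⟩, ⟨n, .inr rfl⟩]

/-- The coefficients of the linear form `∑ n, s n * (z (π (2n)) - z (π (2n+1)))` in `z`. -/
noncomputable def incrementCoeff (hd : Even d) (π : Pairing d) (s : Fin (d / 2) → ℝ)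
    (v : ZMod d) : ℝ :=
  Sum.elim s (-s) ((vertexEquiv hd π).symm v)

lemma sum_incrementCoeff_mul (hd : Even d) (π : Pairing d) (s : Fin (d / 2) → ℝ)
    (z : ZMod d → ℝ) :
    ∑ v, π.incrementCoeff hd s v * z v = ∑ n, s n * (z (π.fst n) - z (π.snd n)) := by
  rw [← (vertexEquiv hd π).sum_comp, Fintype.sum_sum_type, ← Finset.sum_add_distrib]
  refine Finset.sum_congr rfl fun n _ => ?_
  simp only [incrementCoeff, Equiv.symm_apply_apply, Sum.elim_inl, Sum.elim_inr, Pi.neg_apply]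
  rw [vertexEquiv_inl, vertexEquiv_inr]
  ring

lemma abs_incrementCoeff_le_one (hd : Even d) (π : Pairing d) {s : Fin (d / 2) → ℝ}
    (hs : ∀ n, |s n| ≤ 1) (v : ZMod d) : |π.incrementCoeff hd s v| ≤ 1 := by
  unfold incrementCoeff
  cases (vertexEquiv hd π).symm v <;> simp [hs]

lemma variation_eq_half_sum_partner (hd : Even d) (π : Pairing d) (z : ZMod d → ℝ) :
    π.variation z = 2⁻¹ * ∑ v, |z v - z (partner hd π v)| := by
  rw [← (vertexEquiv hd π).sum_comp, Fintype.sum_sum_type]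
  simp only [vertexEquiv_inl, vertexEquiv_inr, partner_fst, partner_snd,
    abs_sub_comm (z (π.snd _)), variation]
  ring

lemma totalVariation_eq_of_partner_eq (hd : Even d) {π π' : Pairing d}
    (h : partner hd π = partner hd π') {N : ℕ} (x : Fin N → ZMod d → ℝ) :
    totalVariation x π = totalVariation x π' := by
  simp only [totalVariation_eq_sum_variation, variation_eq_half_sum_partner hd, h]

open Classical in
lemma card_farPairs (hd : Even d) (π : Pairing d) :
    π.farPairs.card = Finset.card {n | ¬ Neighbor (π.fst n) (π.snd n)} :=
  Finset.card_image_of_injective _ fun _ _ h =>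
    Sum.inl_injective ((bijective_sumElim hd π).injective (congrArg Prod.fst h))

lemma partner_eq_and_not_neighbor_iff (hd : Even d) {π : Pairing d} {v w : ZMod d} :
    partner hd π v = w ∧ ¬ Neighbor v w ↔ (v, w) ∈ π.farPairs ∨ (w, v) ∈ π.farPairs := by
  simp only [mem_farPairs, Prod.mk.injEq]
  constructor
  · rintro ⟨rfl, hv⟩
    obtain ⟨n, rfl | rfl⟩ := exists_eq_fst_or_eq_snd hd π v
    · exact .inl ⟨n, by simpa using hv⟩
    · exact .inr ⟨n, by simpa [neighbor_comm] using hv⟩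
  · rintro (⟨n, hn, rfl, rfl⟩ | ⟨n, hn, rfl, rfl⟩)
    · exact ⟨partner_fst hd π n, hn⟩
    · exact ⟨partner_snd hd π n, neighbor_comm.not.1 hn⟩

lemma partner_eq_of_farPairs_eq (hd : Even d) {π π' : Pairing d} (h : π.farPairs = π'.farPairs)
    (hne : π.farPairs.Nonempty) : partner hd π = partner hd π' := by
  have hiff (v w : ZMod d) : (partner hd π v = w ∧ ¬ Neighbor v w) ↔
      (partner hd π' v = w ∧ ¬ Neighbor v w) := by
    rw [partner_eq_and_not_neighbor_iff, partner_eq_and_not_neighbor_iff, h]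
  obtain ⟨⟨s, t⟩, hst⟩ := hne
  have hs := (partner_eq_and_not_neighbor_iff hd).2 (.inl hst)
  refine eq_of_eq_of_not_neighbor (partner_involutive hd π) (partner_involutive hd π') ?_
    (hs.1.trans ((hiff s t).1 hs).1.symm)
  rintro v (hv | hv)
  · exact ((hiff v _).1 ⟨rfl, hv⟩).1.symm
  · exact ((hiff v _).2 ⟨rfl, hv⟩).1

/-- The connected pairing of the vertices `2n` and `2n+1`. -/
def standard (d : ℕ) [NeZero d] : Pairing d where
  toFun i := (i : ℕ)
  invFun v := ⟨v.val, ZMod.val_lt v⟩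
  left_inv i := by
    ext
    simp [ZMod.val_natCast, Nat.mod_eq_of_lt i.2]
  right_inv v := by simp

lemma isConnected_standard : (standard d).IsConnected :=
  fun n => .inr (by simp [standard, fst, snd])

end Pairing

section Correlation

variable {d : ℕ}

lemma sum_sum_mul_le_covOpNorm [NeZero d] (ρ a : ZMod d → ℝ) :
    ∑ u, ∑ v, a u * a v * ρ (u - v) ≤ covOpNorm ρ * ∑ v, a v ^ 2 := by
  let A : EuclideanSpace ℝ (ZMod d) := WithLp.toLp 2 a
  have hform : ∑ u, ∑ v, a u * a v * ρ (u - v) =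
      inner ℝ A (Matrix.toEuclideanCLM (𝕜 := ℝ) (covMatrix ρ) A) := by
    simp only [Matrix.inner_toEuclideanCLM, A, covMatrix, Matrix.mulVec, dotProduct,
      Matrix.circulant_apply, Finset.mul_sum]
    exact Finset.sum_congr rfl fun u _ => Finset.sum_congr rfl fun v _ => by ring
  have hnorm : ∑ v, a v ^ 2 = ‖A‖ ^ 2 := by simp [EuclideanSpace.norm_sq_eq, A]
  calc ∑ u, ∑ v, a u * a v * ρ (u - v)
      ≤ ‖A‖ * ‖Matrix.toEuclideanCLM (𝕜 := ℝ) (covMatrix ρ) A‖ :=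
        hform.trans_le (real_inner_le_norm _ _)
    _ ≤ ‖A‖ * (covOpNorm ρ * ‖A‖) := by
        gcongr
        exact ContinuousLinearMap.le_opNorm _ _
    _ = covOpNorm ρ * ∑ v, a v ^ 2 := by rw [hnorm]; ring

lemma le_maxFarCorr [NeZero d] (ρ : ZMod d → ℝ) {u v : ZMod d} (huv : u ≠ v)
    (h : ¬ Neighbor u v) : ρ (u - v) ≤ maxFarCorr ρ := by
  refine le_csSup (Set.toFinite _).bddAbove
    ⟨u - v, ⟨sub_ne_zero.2 huv, fun h1 => h (.inl h1), fun h1 => h (.inr ?_)⟩, rfl⟩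
  rw [← neg_sub, h1, neg_neg]

lemma natCast_ne_zero_of_pos_of_lt {m : ℕ} (hm : 0 < m) (hmd : m < d) : (m : ZMod d) ≠ 0 := by
  rw [Ne, ZMod.natCast_eq_zero_iff]
  exact Nat.not_dvd_of_pos_of_lt hm hmd

lemma not_neighbor_two_zero (hd : 4 ≤ d) : ¬ Neighbor (2 : ZMod d) 0 := by
  rintro (h | h)
  · exact natCast_ne_zero_of_pos_of_lt (d := d) one_pos (by omega)
      (by push_cast; linear_combination h)
  · exact natCast_ne_zero_of_pos_of_lt (d := d) three_pos (by omega)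
      (by push_cast; linear_combination -h)

/-- With `r = 4 ρ 0 / π`, all three terms are multiples of `√r`. -/
lemma sqrt_add_sqrt_corrGap {ρ : ZMod d → ℝ} (hρ0 : 0 < ρ 0) (hρ : maxFarCorr ρ ≤ ρ 1) :
    √(4 * (ρ 0 - ρ 1) / Real.pi) + √(4 * ρ 0 * corrGap ρ / Real.pi) =
      √(4 * (ρ 0 - maxFarCorr ρ) / Real.pi) := by
  have hfactor (r : ℝ) :
      √(4 * (ρ 0 - r) / Real.pi) = √(4 * ρ 0 / Real.pi) * √(1 - r / ρ 0) := by
    rw [← Real.sqrt_mul (by positivity)]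
    congr 1
    field_simp
  have hmono : √(1 - ρ 1 / ρ 0) ≤ √(1 - maxFarCorr ρ / ρ 0) := by gcongr
  have hgap : √(4 * ρ 0 * corrGap ρ / Real.pi) =
      √(4 * ρ 0 / Real.pi) * (√(1 - maxFarCorr ρ / ρ 0) - √(1 - ρ 1 / ρ 0)) := by
    rw [mul_div_right_comm, Real.sqrt_mul (by positivity), corrGap,
      Real.sqrt_sq (sub_nonneg.2 hmono)]
  rw [hfactor, hfactor, hgap]
  ring

end Correlation

namespace IsCircularStationaryGaussian

variable {Ω : Type*} [MeasurableSpace Ω] {d : ℕ} [NeZero d] {x : Ω → ZMod d → ℝ} {c : ℝ}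
  {ρ : ZMod d → ℝ} {P : Measure Ω}

lemma hasGaussianLaw_sub (hx : IsCircularStationaryGaussian x c ρ P) (u v : ZMod d) :
    HasGaussianLaw (fun ω => x ω u - x ω v) P :=
  hx.gaussian.map_fun ((ContinuousLinearMap.proj u : (ZMod d → ℝ) →L[ℝ] ℝ) -
    ContinuousLinearMap.proj v)

lemma memLp_two (hx : IsCircularStationaryGaussian x c ρ P) (v : ZMod d) :
    MemLp (fun ω => x ω v) 2 P :=
  (hx.gaussian.map_fun (ContinuousLinearMap.proj v : (ZMod d → ℝ) →L[ℝ] ℝ)).memLp_two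

lemma corr_neg (hx : IsCircularStationaryGaussian x c ρ P) (n : ZMod d) : ρ (-n) = ρ n := by
  simpa [covariance_comm] using (hx.cov 0 n).symm.trans
    ((covariance_comm _ _).trans (hx.cov n 0))

lemma corr_of_neighbor (hx : IsCircularStationaryGaussian x c ρ P) {u v : ZMod d}
    (h : Neighbor u v) : ρ (u - v) = ρ 1 := by
  rcases h with h | h
  · rw [h]
  · rw [← neg_sub, h, hx.corr_neg]

lemma variance_eq (hx : IsCircularStationaryGaussian x c ρ P) (v : ZMod d) :
    Var[fun ω => x ω v; P] = ρ 0 := by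
  rw [← covariance_self (hx.memLp_two v).aemeasurable, hx.cov, sub_self]

lemma integrable_variation (hx : IsCircularStationaryGaussian x c ρ P) (π : Pairing d) :
    Integrable (fun ω => π.variation (x ω)) P :=
  integrable_finsetSum _ fun _ _ => (hx.hasGaussianLaw_sub _ _).integrable.abs

variable [IsProbabilityMeasure P]

lemma variance_sub (hx : IsCircularStationaryGaussian x c ρ P) (u v : ZMod d) :
    Var[fun ω => x ω u - x ω v; P] = 2 * (ρ 0 - ρ (u - v)) := by
  rw [variance_fun_sub (hx.memLp_two u) (hx.memLp_two v), hx.variance_eq, hx.variance_eq, hx.cov]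
  ring

lemma variance_add (hx : IsCircularStationaryGaussian x c ρ P) (u v : ZMod d) :
    Var[fun ω => x ω u + x ω v; P] = 2 * (ρ 0 + ρ (u - v)) := by
  rw [variance_fun_add (hx.memLp_two u) (hx.memLp_two v), hx.variance_eq, hx.variance_eq, hx.cov]
  ring

lemma abs_corr_le (hx : IsCircularStationaryGaussian x c ρ P) (n : ZMod d) : |ρ n| ≤ ρ 0 := by
  have hsub := hx.variance_sub n 0 ▸ variance_nonneg (fun ω => x ω n - x ω 0) P
  have hadd := hx.variance_add n 0 ▸ variance_nonneg (fun ω => x ω n + x ω 0) P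
  rw [sub_zero] at hsub hadd
  exact abs_le.2 ⟨by linarith, by linarith⟩

lemma corr_zero_pos (hx : IsCircularStationaryGaussian x c ρ P) (hd : 4 ≤ d)
    (hρ : maxFarCorr ρ < ρ 1) : 0 < ρ 0 := by
  have htwo : (2 : ZMod d) ≠ 0 := by
    exact_mod_cast natCast_ne_zero_of_pos_of_lt (d := d) two_pos (by omega)
  have hfar : ρ 2 ≤ maxFarCorr ρ := by
    simpa using le_maxFarCorr ρ htwo (not_neighbor_two_zero hd)
  linarith [(abs_le.1 (hx.abs_corr_le 1)).2, (abs_le.1 (hx.abs_corr_le 2)).1]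

lemma variance_sum_mul_le (hx : IsCircularStationaryGaussian x c ρ P) (a : ZMod d → ℝ) :
    Var[fun ω => ∑ v, a v * x ω v; P] ≤ covOpNorm ρ * ∑ v, a v ^ 2 := by
  rw [variance_fun_sum fun v => (hx.memLp_two v).const_mul (a v)]
  refine le_trans (le_of_eq ?_) (sum_sum_mul_le_covOpNorm ρ a)
  refine Finset.sum_congr rfl fun u _ => Finset.sum_congr rfl fun v _ => ?_
  rw [covariance_const_mul_left, covariance_const_mul_right, hx.cov]
  ring

lemma corr_zero_le_covOpNorm (hx : IsCircularStationaryGaussian x c ρ P) :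
    ρ 0 ≤ covOpNorm ρ := by
  simpa [Pi.single_apply, hx.variance_eq] using hx.variance_sum_mul_le (Pi.single 0 1)

lemma integral_abs_sub (hx : IsCircularStationaryGaussian x c ρ P) (u v : ZMod d) :
    ∫ ω, |x ω u - x ω v| ∂P = √(4 * (ρ 0 - ρ (u - v)) / Real.pi) := by
  have hcenter : ∫ ω, (x ω u - x ω v) ∂P = 0 := by
    rw [integral_sub ((hx.memLp_two u).integrable one_le_two)
      ((hx.memLp_two v).integrable one_le_two), hx.mean, hx.mean, sub_self]
  rw [integral_abs_of_hasGaussianLaw_of_centered (hx.hasGaussianLaw_sub u v) hcenter,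
    hx.variance_sub]
  ring_nf

lemma integral_variation (hx : IsCircularStationaryGaussian x c ρ P) (π : Pairing d) :
    ∫ ω, π.variation (x ω) ∂P = ∑ n, √(4 * (ρ 0 - ρ (π.fst n - π.snd n)) / Real.pi) := by
  simp only [Pairing.variation, ← hx.integral_abs_sub]
  exact integral_finsetSum _ fun _ _ => (hx.hasGaussianLaw_sub _ _).integrable.abs

lemma integral_variation_of_isConnected (hx : IsCircularStationaryGaussian x c ρ P)
    {π : Pairing d} (hπ : π.IsConnected) :
    ∫ ω, π.variation (x ω) ∂P = (d / 2 : ℕ) * √(4 * (ρ 0 - ρ 1) / Real.pi) := by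
  simp [hx.integral_variation, hx.corr_of_neighbor (hπ _)]

lemma le_integral_variation (hx : IsCircularStationaryGaussian x c ρ P) (hd : Even d)
    (hρ0 : 0 < ρ 0) (hρ : maxFarCorr ρ ≤ ρ 1) (π : Pairing d) :
    (d / 2 : ℕ) * √(4 * (ρ 0 - ρ 1) / Real.pi) +
        π.farPairs.card * √(4 * ρ 0 * corrGap ρ / Real.pi) ≤ ∫ ω, π.variation (x ω) ∂P := by
  classical
  have hterm (n : Fin (d / 2)) : √(4 * (ρ 0 - ρ 1) / Real.pi) +
      (if ¬ Neighbor (π.fst n) (π.snd n) then √(4 * ρ 0 * corrGap ρ / Real.pi) else 0) ≤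
        √(4 * (ρ 0 - ρ (π.fst n - π.snd n)) / Real.pi) := by
    split_ifs with hn
    · rw [hx.corr_of_neighbor hn, add_zero]
    · rw [sqrt_add_sqrt_corrGap hρ0 hρ]
      gcongr
      exact le_maxFarCorr ρ (π.fst_ne_snd n) hn
  calc _ = ∑ n, (√(4 * (ρ 0 - ρ 1) / Real.pi) +
        if ¬ Neighbor (π.fst n) (π.snd n) then √(4 * ρ 0 * corrGap ρ / Real.pi) else 0) := by
        rw [Finset.sum_add_distrib, ← Finset.sum_filter, Pairing.card_farPairs hd]
        simp
    _ ≤ ∑ n, √(4 * (ρ 0 - ρ (π.fst n - π.snd n)) / Real.pi) :=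
        Finset.sum_le_sum fun n _ => hterm n
    _ = ∫ ω, π.variation (x ω) ∂P := (hx.integral_variation π).symm

lemma integral_variation_sub_le (hx : IsCircularStationaryGaussian x c ρ P) (hd : Even d)
    (hρ0 : 0 < ρ 0) (hρ : maxFarCorr ρ ≤ ρ 1) {σ : Pairing d} (hσ : σ.IsConnected)
    (π : Pairing d) :
    ∫ ω, (σ.variation (x ω) - π.variation (x ω)) ∂P ≤
      -(π.farPairs.card * √(4 * ρ 0 * corrGap ρ / Real.pi)) := by
  rw [integral_sub (hx.integrable_variation σ) (hx.integrable_variation π),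
    hx.integral_variation_of_isConnected hσ]
  linarith [hx.le_integral_variation hd hρ0 hρ π]

/-- The linear form has at most two coefficients in `[-1, 1]` at each vertex, so the squares of its
coefficients sum to at most `4 d`. -/
lemma variance_sum_mul_sub_add_sum_mul_sub_le (hx : IsCircularStationaryGaussian x c ρ P)
    (hd : Even d) (σ π : Pairing d) {s t : Fin (d / 2) → ℝ} (hs : ∀ n, |s n| ≤ 1)
    (ht : ∀ n, |t n| ≤ 1) :
    Var[fun ω => ∑ n, s n * (x ω (σ.fst n) - x ω (σ.snd n)) +
        ∑ n, t n * (x ω (π.fst n) - x ω (π.snd n)); P] ≤ 4 * (d * covOpNorm ρ) := by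
  let b (v : ZMod d) : ℝ := σ.incrementCoeff hd s v + π.incrementCoeff hd t v
  have hsum (ω : Ω) : ∑ n, s n * (x ω (σ.fst n) - x ω (σ.snd n)) +
      ∑ n, t n * (x ω (π.fst n) - x ω (π.snd n)) = ∑ v, b v * x ω v := by
    simp only [b, add_mul, Finset.sum_add_distrib, Pairing.sum_incrementCoeff_mul]
  have hb (v : ZMod d) : b v ^ 2 ≤ 4 := by
    have hbv : |b v| ≤ 2 := (abs_add_le _ _).trans <| by
      linarith [σ.abs_incrementCoeff_le_one hd hs v, π.abs_incrementCoeff_le_one hd ht v]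
    nlinarith [sq_abs (b v), abs_nonneg (b v)]
  simp only [hsum]
  calc Var[fun ω => ∑ v, b v * x ω v; P]
      ≤ covOpNorm ρ * ∑ v, b v ^ 2 := hx.variance_sum_mul_le b
    _ ≤ covOpNorm ρ * ∑ _v : ZMod d, 4 := by
        gcongr with v
        · exact norm_nonneg _
        · exact hb v
    _ = 4 * (d * covOpNorm ρ) := by
        simp only [Finset.sum_const, Finset.card_univ, ZMod.card, nsmul_eq_mul]
        ring

lemma hasSubgaussianMGF_variation_sub (hx : IsCircularStationaryGaussian x c ρ P) (hd : Even d)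
    (σ π : Pairing d) :
    HasSubgaussianMGF (fun ω => σ.variation (x ω) - π.variation (x ω) -
        ∫ ω', (σ.variation (x ω') - π.variation (x ω')) ∂P)
      (Real.toNNReal (Real.pi ^ 2 * (d * covOpNorm ρ))) P := by
  let increment (τ : Pairing d) (n : Fin (d / 2)) : StrongDual ℝ (ZMod d → ℝ) :=
    (ContinuousLinearMap.proj (τ.fst n) : (ZMod d → ℝ) →L[ℝ] ℝ) -
      ContinuousLinearMap.proj (τ.snd n)
  let w : Fin (d / 2) ⊕ Fin (d / 2) → ℝ := Sum.elim 1 (-1)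
  have hvar (a : Fin (d / 2) ⊕ Fin (d / 2) → ℝ) (ha : ∀ j, |a j| ≤ |w j|) :
      Var[fun ω => ∑ j, a j * Sum.elim (increment σ) (increment π) j (x ω); P] ≤
        4 * (d * covOpNorm ρ) := by
    simpa [increment] using hx.variance_sum_mul_sub_add_sum_mul_sub_le hd σ π
      (s := a ∘ Sum.inl) (t := a ∘ Sum.inr) (fun n => by simpa [w] using ha (.inl n))
      (fun n => by simpa [w] using ha (.inr n))
  have hf (ω : Ω) : ∑ j, w j * |Sum.elim (increment σ) (increment π) j (x ω)| =
      σ.variation (x ω) - π.variation (x ω) := by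
    simp [w, increment, Pairing.variation, sub_eq_add_neg]
  have hc : (Real.pi / 2) ^ 2 * (4 * (d * covOpNorm ρ)) = Real.pi ^ 2 * (d * covOpNorm ρ) := by
    ring
  simpa only [hf, hc] using hasSubgaussianMGF_sum_abs_dual hx.gaussian
    (Sum.elim (increment σ) (increment π)) w hvar

end IsCircularStationaryGaussian

lemma exp_neg_lt_div_pow_three {d K r Δ ε N : ℝ} (hd : 0 < d) (hK : 0 < K) (hr : 0 < r)
    (hΔ : 0 < Δ) (hε : 0 < ε)
    (hN : Real.pi ^ 3 * (K / r) / (2 * Δ) * d * (3 * Real.log d - Real.log ε) < N) :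
    Real.exp (-(2 * N * (r * Δ) / (Real.pi ^ 3 * d * K))) < ε / d ^ 3 := by
  have hpi := Real.pi_pos
  have hrate : 3 * Real.log d - Real.log ε < 2 * N * (r * Δ) / (Real.pi ^ 3 * d * K) := by
    rw [lt_div_iff₀ (by positivity)]
    rw [mul_div_assoc', div_div, div_mul_eq_mul_div, div_mul_eq_mul_div,
      div_lt_iff₀ (by positivity)] at hN
    linarith
  rw [← Real.lt_log_iff_exp_lt (by positivity), Real.log_div hε.ne' (by positivity), Real.log_pow]
  push_cast
  linarith

section Samples

variable {Ω Ω' : Type*} [MeasurableSpace Ω] [MeasurableSpace Ω'] {d N : ℕ} [NeZero d]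
  {X : Fin N → Ω → ZMod d → ℝ} {P : Measure Ω}

/-- A pairing that is not connected is determined, up to the order of its pairs and of their ends,
by its far pairs, so the union runs over nonempty sets of pairs of vertices only. -/
lemma measureReal_exists_not_isConnected_le [IsFiniteMeasure P] (hd : Even d) (σ : Pairing d)
    {p : ℝ} (hp : 0 ≤ p)
    (h : ∀ π : Pairing d, P.real {ω | Pairing.totalVariation (fun i => X i ω) π ≤
      Pairing.totalVariation (fun i => X i ω) σ} ≤ p ^ π.farPairs.card) :
    P.real {ω | ∃ π : Pairing d, ¬ π.IsConnected ∧ Pairing.totalVariation (fun i => X i ω) π ≤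
      Pairing.totalVariation (fun i => X i ω) σ} ≤ (1 + p) ^ d ^ 2 - 1 := by
  classical
  let E (F : Finset (ZMod d × ZMod d)) : Set Ω := {ω | ∃ π : Pairing d, π.farPairs = F ∧
    Pairing.totalVariation (fun i => X i ω) π ≤ Pairing.totalVariation (fun i => X i ω) σ}
  have hE (F : Finset (ZMod d × ZMod d)) (hF : F.Nonempty) : P.real (E F) ≤ p ^ F.card := by
    by_cases hex : ∃ π : Pairing d, π.farPairs = F
    · obtain ⟨π, rfl⟩ := hex
      refine (measureReal_mono ?_).trans (h π)
      rintro ω ⟨π', hfar, hle⟩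
      have hpartner := Pairing.partner_eq_of_farPairs_eq hd hfar.symm hF
      exact (Pairing.totalVariation_eq_of_partner_eq hd hpartner _).trans_le hle
    · have hempty : E F = ∅ :=
        Set.eq_empty_of_forall_notMem fun ω ⟨π, hπ, _⟩ => hex ⟨π, hπ⟩
      rw [hempty, measureReal_empty]
      positivity
  calc _ ≤ P.real (⋃ F ∈ ({F | F.Nonempty} : Finset (Finset (ZMod d × ZMod d))), E F) := by
        refine measureReal_mono ?_ (measure_ne_top _ _)
        rintro ω ⟨π, hπ, hle⟩
        rw [Pairing.isConnected_iff_farPairs_eq_empty, ← Ne, ← Finset.nonempty_iff_ne_empty] at hπ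
        exact Set.mem_biUnion (by simpa using hπ) ⟨π, rfl, hle⟩
    _ ≤ ∑ F : Finset (ZMod d × ZMod d) with F.Nonempty, P.real (E F) :=
        measureReal_biUnion_finset_le _ _
    _ ≤ ∑ F : Finset (ZMod d × ZMod d) with F.Nonempty, p ^ F.card :=
        Finset.sum_le_sum fun F hF => hE F (Finset.mem_filter.1 hF).2
    _ = (1 + p) ^ d ^ 2 - 1 := by
        rw [sum_nonempty_pow_card, Fintype.card_prod, ZMod.card, sq]

variable {Q : Measure Ω'} [IsProbabilityMeasure Q] {x : Ω' → ZMod d → ℝ} {c : ℝ} {ρ : ZMod d → ℝ}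

lemma measureReal_totalVariation_le (hd : Even d) (hx : IsCircularStationaryGaussian x c ρ Q)
    (hρ0 : 0 < ρ 0) (hρ : maxFarCorr ρ ≤ ρ 1) (hX : ∀ i, IdentDistrib (X i) x P Q)
    (hX_indep : iIndepFun X P) {σ : Pairing d} (hσ : σ.IsConnected) (π : Pairing d) :
    P.real {ω | Pairing.totalVariation (fun i => X i ω) π ≤
        Pairing.totalVariation (fun i => X i ω) σ} ≤
      Real.exp (-(2 * N * (ρ 0 * corrGap ρ) / (Real.pi ^ 3 * d * covOpNorm ρ))) ^
        π.farPairs.card ^ 2 := by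
  have hf : Measurable fun z : ZMod d → ℝ => σ.variation z - π.variation z := by
    unfold Pairing.variation
    fun_prop
  have htail := measureReal_sum_nonneg_le_of_iIndepFun hX hX_indep hf
    (hx.hasSubgaussianMGF_variation_sub hd σ π) (by positivity)
    (hx.integral_variation_sub_le hd hρ0 hρ hσ π)
  have hgap : 0 ≤ 4 * ρ 0 * corrGap ρ / Real.pi := by unfold corrGap; positivity
  have hK : 0 ≤ Real.pi ^ 2 * (d * covOpNorm ρ) := by unfold covOpNorm; positivity
  rw [Real.coe_toNNReal _ hK, mul_pow, Real.sq_sqrt hgap, Fintype.card_fin] at htail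
  simp only [Finset.sum_sub_distrib, sub_nonneg, ← Pairing.totalVariation_eq_sum_variation] at htail
  refine htail.trans_eq ?_
  rw [← Real.exp_nat_mul]
  push_cast
  congr 1
  ring

lemma measureReal_exists_not_isConnected_lt (hd : 4 ≤ d) (hd_even : Even d)
    (hx : IsCircularStationaryGaussian x c ρ Q) (hρ : maxFarCorr ρ < ρ 1)
    (hΔ : 0 < corrGap ρ) (hX : ∀ i, IdentDistrib (X i) x P Q) (hX_indep : iIndepFun X P)
    {σ : Pairing d} (hσ : σ.IsConnected) {ε : ℝ} (hε : 0 < ε) (hε1 : ε ≤ 1)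
    (hN : Real.pi ^ 3 * (covOpNorm ρ / ρ 0) / (2 * corrGap ρ) * d *
      (3 * Real.log d - Real.log ε) < N) :
    P.real {ω | ∃ π : Pairing d, ¬ π.IsConnected ∧ Pairing.totalVariation (fun i => X i ω) π ≤
      Pairing.totalVariation (fun i => X i ω) σ} < ε := by
  have hprob : IsProbabilityMeasure P := hX_indep.isProbabilityMeasure
  have hρ0 : 0 < ρ 0 := hx.corr_zero_pos hd hρ
  have hK : 0 < covOpNorm ρ := hρ0.trans_le hx.corr_zero_le_covOpNorm
  have hd4 : (4 : ℝ) ≤ d := mod_cast hd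
  have hd0 : (0 : ℝ) < d := by linarith
  let p := Real.exp (-(2 * N * (ρ 0 * corrGap ρ) / (Real.pi ^ 3 * d * covOpNorm ρ)))
  have hp0 : 0 ≤ p := Real.exp_nonneg _
  have hp1 : p ≤ 1 := Real.exp_le_one_iff.2 (neg_nonpos.2 (by positivity))
  have hdp : (d ^ 2 : ℕ) * p < ε / 4 := by
    calc ((d ^ 2 : ℕ) : ℝ) * p < (d ^ 2 : ℕ) * (ε / d ^ 3) := by
          gcongr
          exact exp_neg_lt_div_pow_three hd0 hK hρ0 hΔ hε hN
      _ = ε / d := by push_cast; field_simp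
      _ ≤ ε / 4 := by gcongr
  calc _ ≤ (1 + p) ^ d ^ 2 - 1 :=
        measureReal_exists_not_isConnected_le hd_even σ hp0 fun π =>
          (measureReal_totalVariation_le hd_even hx hρ0 hρ.le hX hX_indep hσ π).trans
            (pow_le_pow_of_le_one hp0 hp1 (Nat.le_self_pow two_ne_zero _))
    _ ≤ 2 * ((d ^ 2 : ℕ) * p) := one_add_pow_sub_one_le hp0 (by linarith)
    _ < ε := by linarith

end Samples

end RingPairing

theorem mainTheorem1 {Ω Ω' : Type*} [MeasurableSpace Ω] [MeasurableSpace Ω']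
    (P : Measure Ω) [IsProbabilityMeasure P] (Q : Measure Ω') [IsProbabilityMeasure Q]
    (d : ℕ) [NeZero d] (hd : 4 ≤ d) (hd_even : Even d)
    (x : Ω' → ZMod d → ℝ) (c : ℝ) (ρ : ZMod d → ℝ)
    (hx : RingPairing.IsCircularStationaryGaussian x c ρ Q)
    (hρ : RingPairing.maxFarCorr ρ < ρ 1)
    (hΔ : 0 < RingPairing.corrGap ρ)
    (N : ℕ) (X : Fin N → Ω → ZMod d → ℝ)
    (hX : ∀ i, IdentDistrib (X i) x P Q)
    (hX_indep : iIndepFun X P)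
    (ε : ℝ) (hε : 0 < ε)
    (hN : Real.pi ^ 3 * (RingPairing.covOpNorm ρ / ρ 0) / (2 * RingPairing.corrGap ρ)
      * d * (3 * Real.log d - Real.log ε) < N) :
    1 - ε < P.real {ω | ∀ π : RingPairing.Pairing d,
      RingPairing.Pairing.IsMinimizer (fun i => X i ω) π → π.IsConnected} := by
  rcases lt_or_ge 1 ε with hε1 | hε1
  · exact (sub_neg.2 hε1).trans_le measureReal_nonneg
  set S : Set Ω := {ω | ∀ π : RingPairing.Pairing d,
    RingPairing.Pairing.IsMinimizer (fun i => X i ω) π → π.IsConnected} with hS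
  have hcompl : P.real Sᶜ < ε := by
    refine (measureReal_mono ?_).trans_lt <| RingPairing.measureReal_exists_not_isConnected_lt
      hd hd_even hx hρ hΔ hX hX_indep (RingPairing.Pairing.isConnected_standard (d := d)) hε hε1 hN
    intro ω hω
    simp only [hS, Set.mem_compl_iff, Set.mem_ofPred_eq, not_forall] at hω
    obtain ⟨π, hmin, hπ⟩ := hω
    exact ⟨π, hπ, hmin _⟩
  have htotal : 1 ≤ P.real S + P.real Sᶜ := by
    simpa using measureReal_union_le (μ := P) S Sᶜ
  linarith
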